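/- Let $\mathbb{T}=\mathbb{R}\cup\mathbb{R}^\nu\cup\{-\infty\}$ be the extended tropical semiring, where $\mathbb{R}^\nu=\{a^\nu : a\in\mathbb{R}\}$ is a second (ghost) copy of the reals. It is totally ordered by: $-\infty$ is the least element; for real $a<b$ one has $a\prec b$, $a\prec b^\nu$, $a^\nu\prec b$, $a^\nu\prec b^\nu$; and $a\prec a^\nu$ for every real $a$. The operations are $x\oplus y=\max_\prec\{x,y\}$ if $x\ne y$, $a\oplus a=a^\nu\oplus a^\nu=a^\nu$ for $a\in\mathbb R$, $(-\infty)\oplus(-\infty)=-\infty$; and $a\odot b=a+b$, $a^\nu\odot b=a\odot b^\nu=a^\nu\odot b^\nu=(a+b)^\nu$ for $a,b\in\mathbb R$, $(-\infty)\odot x=x\odot(-\infty)=-\infty$. The zero is $-\infty$ and the unit is the real number $0$. Sums and products of matrices over $\mathbb T$ are formed with $\oplus$ and $\odot$; write $\overline{\mathbb R}=\mathbb R\cup\{-\infty\}$ and $\overline{\mathbb U}=\mathbb R^\nu\cup\{-\infty\}$. Vectors $v_1,\dots,v_m\in\mathbb{T}^{(n)}$ are tropically dependent if there are $\alpha_1,\dots,\alpha_m\in\overline{\mathbb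 R}$, not all $-\infty$, with $\alpha_1v_1\oplus\cdots\oplus\alpha_mv_m\in\overline{\mathbb U}^{(n)}$; otherwise they are tropically independent. The rank of a matrix is the maximal number of tropically independent rows in it. For an $n\times n$ matrix $A=(a_{i,j})$ over $\mathbb T$ let $|A|=\bigoplus_{\sigma\in S_n}a_{1,\sigma(1)}\odot\cdots\odot a_{n,\sigma(n)}$; $A$ is tropically singular if $|A|\in\overline{\mathbb U}$, and tropically nonsingular otherwise. Let $\operatorname{adj}(A)$ be the $n\times n$ matrix whose $(i,j)$ entry is $|A_{j,i}|$, where $A_{j,i}$ is obtained from $A$ by deleting row $j$ and column $i$ (the determinant of the empty matrix is the unit $0$). A pseudo unit matrix is a tropically nonsingular $n\times n$ matrix with all diagonal entries equal to the real number $0$ and all off-diagonal entries in $\overline{\mathbb U}$. A matrix $B\in M_{n\times n}(\mathbb T)$ is a pseudo inverse of $A$ if $AB$ and $BA$ are both pseudo unit matrices, and $A$ is pseudo invertible if it has a pseudo inverse. Then for every $A\in M_{n\times n}(\mathbb T)$ the following are equivalent: (i) $A$ has rank $n$; (ii) $A$ is tropically nonsingular; (iii) $A$ is pseudo invertible. Moreover,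 if $A$ is tropically nonsingular (so that $|A|\in\mathbb R$), then $\frac{\operatorname{adj}(A)}{|A|}$, the matrix obtained from $\operatorname{adj}(A)$ by $\odot$-multiplying every entry with the real number $-|A|$, is a pseudo inverse of $A$. -/

import Mathlib

/-- The extended tropical semiring `𝕋`: a copy of the reals (the real part), a second copy of the
reals (the ghost part, `ghost a` is `a^ν`), and one common element `-∞`. -/
inductive ExtTrop : Type
  | negInf : ExtTrop
  | real (a : ℝ) : ExtTrop
  | ghost (a : ℝ) : ExtTrop

namespace ExtTrop

/-- The position of an element of `𝕋` in the total order: `-∞` is the least element, the other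
elements are compared by their value first, and `a` comes before `a^ν`. -/
def toKey : ExtTrop → WithBot (ℝ ×ₗ Bool)
  | negInf => ⊥
  | real a => ((toLex (a, false) : ℝ ×ₗ Bool) : WithBot (ℝ ×ₗ Bool))
  | ghost a => ((toLex (a, true) : ℝ ×ₗ Bool) : WithBot (ℝ ×ₗ Bool))

theorem toKey_injective : Function.Injective toKey := by
  rintro (_ | a | a) (_ | b | b) h <;> simp_all [toKey]

noncomputable instance : LinearOrder ExtTrop := LinearOrder.lift' toKey toKey_injective

theorem lt_iff_toKey (x y : ExtTrop) : x < y ↔ toKey x < toKey y := Iff.rfl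

theorem negInf_lt_real (a : ℝ) : negInf < real a := by simp [lt_iff_toKey, toKey]

theorem negInf_lt_ghost (a : ℝ) : negInf < ghost a := by simp [lt_iff_toKey, toKey]

theorem real_lt_real (a b : ℝ) : real a < real b ↔ a < b := by
  simp [lt_iff_toKey, toKey, Prod.Lex.toLex_lt_toLex]

theorem ghost_lt_ghost (a b : ℝ) : ghost a < ghost b ↔ a < b := by
  simp [lt_iff_toKey, toKey, Prod.Lex.toLex_lt_toLex]

theorem real_lt_ghost (a b : ℝ) : real a < ghost b ↔ a ≤ b := by
  simp [lt_iff_toKey, toKey, Prod.Lex.toLex_lt_toLex, le_iff_lt_or_eq]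

theorem ghost_lt_real (a b : ℝ) : ghost a < real b ↔ a < b := by
  simp [lt_iff_toKey, toKey, Prod.Lex.toLex_lt_toLex]

/-- The ghost map `ν`. -/
def nu : ExtTrop → ExtTrop
  | negInf => negInf
  | real a => ghost a
  | ghost a => ghost a

/-- `x ⊕ y` is the maximum of `x` and `y` if `x ≠ y`, and `x ⊕ x = x^ν`. -/
noncomputable instance : Add ExtTrop := ⟨fun x y => if x = y then nu x else max x y⟩

/-- The product `x ⊙ y`: values are added, and the product is a ghost if one factor is a ghost. -/
noncomputable instance : Mul ExtTrop := ⟨fun x y =>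
  match x, y with
  | negInf, _ => negInf
  | _, negInf => negInf
  | real a, real b => real (a + b)
  | real a, ghost b => ghost (a + b)
  | ghost a, real b => ghost (a + b)
  | ghost a, ghost b => ghost (a + b)⟩

/-- The zero of `𝕋` is `-∞`. -/
instance : Zero ExtTrop := ⟨negInf⟩

/-- The unit of `𝕋` is the real number `0`. -/
noncomputable instance : One ExtTrop := ⟨real 0⟩

theorem zero_def : (0 : ExtTrop) = negInf := rfl

theorem one_def : (1 : ExtTrop) = real 0 := rfl

theorem add_def (x y : ExtTrop) : x + y = if x = y then nu x else max x y := rfl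

theorem negInf_add (x : ExtTrop) : negInf + x = x := by
  rcases x with _ | a | a
  · simp [add_def, nu]
  · simp [add_def, (negInf_lt_real a).le]
  · simp [add_def, (negInf_lt_ghost a).le]

protected theorem add_comm' (x y : ExtTrop) : x + y = y + x := by
  by_cases h : x = y
  · rw [h]
  · simp [add_def, h, Ne.symm h, max_comm]

theorem add_negInf (x : ExtTrop) : x + negInf = x := by
  rw [ExtTrop.add_comm', negInf_add]

theorem real_add_real (a b : ℝ) :
    real a + real b = if a < b then real b else if b < a then real a else ghost a := by
  rcases lt_trichotomy a b with h | h | h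
  · simp [add_def, h, h.ne, ((real_lt_real a b).2 h).le]
  · simp [add_def, h, nu]
  · simp [add_def, h, h.ne', h.not_gt, ((real_lt_real b a).2 h).le]

theorem real_add_ghost (a b : ℝ) :
    real a + ghost b = if a ≤ b then ghost b else real a := by
  by_cases h : a ≤ b
  · simp [add_def, h, ((real_lt_ghost a b).2 h).le]
  · simp [add_def, h, ((ghost_lt_real b a).2 (not_le.1 h)).le]

theorem ghost_add_real (a b : ℝ) :
    ghost a + real b = if b ≤ a then ghost a else real b := by
  rw [ExtTrop.add_comm', real_add_ghost]

theorem ghost_add_ghost (a b : ℝ) :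
    ghost a + ghost b = if a ≤ b then ghost b else ghost a := by
  rcases lt_trichotomy a b with h | h | h
  · simp [add_def, h.ne, h.le, ((ghost_lt_ghost a b).2 h).le]
  · simp [add_def, h, nu]
  · simp [add_def, h.ne', h.not_ge, ((ghost_lt_ghost b a).2 h).le]

theorem negInf_mul (x : ExtTrop) : negInf * x = negInf := rfl

theorem mul_negInf (x : ExtTrop) : x * negInf = negInf := by cases x <;> rfl

theorem real_mul_real (a b : ℝ) : real a * real b = real (a + b) := rfl

theorem real_mul_ghost (a b : ℝ) : real a * ghost b = ghost (a + b) := rfl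

theorem ghost_mul_real (a b : ℝ) : ghost a * real b = ghost (a + b) := rfl

theorem ghost_mul_ghost (a b : ℝ) : ghost a * ghost b = ghost (a + b) := rfl

protected theorem add_assoc' (x y z : ExtTrop) : x + y + z = x + (y + z) := by
  rcases x with _ | a | a <;> rcases y with _ | b | b <;> rcases z with _ | c | c <;>
    simp only [negInf_add, add_negInf, real_add_real, real_add_ghost, ghost_add_real,
      ghost_add_ghost] <;>
    grind [real_add_real, real_add_ghost, ghost_add_real, ghost_add_ghost]

protected theorem mul_comm' (x y : ExtTrop) : x * y = y * x := by
  rcases x with _ | a | a <;> rcases y with _ | b | b <;>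
    simp [negInf_mul, mul_negInf, real_mul_real, real_mul_ghost, ghost_mul_real,
      ghost_mul_ghost, add_comm]

protected theorem mul_assoc' (x y z : ExtTrop) : x * y * z = x * (y * z) := by
  rcases x with _ | a | a <;> rcases y with _ | b | b <;> rcases z with _ | c | c <;>
    simp [negInf_mul, mul_negInf, real_mul_real, real_mul_ghost, ghost_mul_real,
      ghost_mul_ghost, add_assoc]

protected theorem one_mul' (x : ExtTrop) : 1 * x = x := by
  rcases x with _ | a | a <;> simp [one_def, mul_negInf, real_mul_real, real_mul_ghost]

protected theorem mul_add' (x y z : ExtTrop) : x * (y + z) = x * y + x * z := by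
  rcases x with _ | a | a <;> rcases y with _ | b | b <;> rcases z with _ | c | c <;>
    simp only [negInf_add, add_negInf, negInf_mul, mul_negInf, real_mul_real, real_mul_ghost,
      ghost_mul_real, ghost_mul_ghost, real_add_real, real_add_ghost, ghost_add_real,
      ghost_add_ghost, add_lt_add_iff_left, add_le_add_iff_left] <;>
    split_ifs <;>
    first | rfl | (exfalso; linarith) | (obtain rfl : b = c := by linarith); rfl

/-- `(𝕋, ⊕, ⊙)` is a commutative semiring. -/
noncomputable instance : CommSemiring ExtTrop where
  add_assoc := ExtTrop.add_assoc'
  zero_add := negInf_add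
  add_zero := add_negInf
  add_comm := ExtTrop.add_comm'
  nsmul := nsmulRec
  zero_mul := negInf_mul
  mul_zero := mul_negInf
  mul_assoc := ExtTrop.mul_assoc'
  one_mul := ExtTrop.one_mul'
  mul_one x := by rw [ExtTrop.mul_comm', ExtTrop.one_mul']
  mul_comm := ExtTrop.mul_comm'
  left_distrib := ExtTrop.mul_add'
  right_distrib x y z := by
    rw [ExtTrop.mul_comm', ExtTrop.mul_add', ExtTrop.mul_comm' z x, ExtTrop.mul_comm' z y]

/-- Division `x / y` (meaningful for `y ≠ -∞`): values are subtracted, and the quotient is a ghost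
if `x` or `y` is a ghost. In particular `x / real b = x ⊙ real (-b)`. -/
noncomputable instance : Div ExtTrop := ⟨fun x y =>
  match y with
  | negInf => negInf
  | real b => x * real (-b)
  | ghost b => x * ghost (-b)⟩

/-- The set `ℝ ∪ {-∞}`. -/
def realBar : Set ExtTrop := {x | x = negInf ∨ ∃ a : ℝ, x = real a}

/-- The set of ghosts together with `-∞`. -/
def ghostBar : Set ExtTrop := {x | x = negInf ∨ ∃ a : ℝ, x = ghost a}

/-- A family of vectors of `𝕋^(n)` is tropically dependent if some combination of them, with
coefficients in `ℝ ∪ {-∞}` that are not all `-∞`, is a ghost vector. -/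
def TropDependent {ι : Type} [Fintype ι] {n : ℕ} (v : ι → Fin n → ExtTrop) : Prop :=
  ∃ α : ι → ExtTrop, (∀ i, α i ∈ realBar) ∧ (∃ i, α i ≠ negInf) ∧
    ∀ j, (∑ i, α i • v i) j ∈ ghostBar

/-- Tropical independence of a family of vectors. -/
def TropIndependent {ι : Type} [Fintype ι] {n : ℕ} (v : ι → Fin n → ExtTrop) : Prop :=
  ¬ TropDependent v

open Classical in
/-- The tropical rank: the maximal number of tropically independent rows. -/
noncomputable def tropRank {m n : ℕ} (A : Matrix (Fin m) (Fin n) ExtTrop) : ℕ :=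
  (Finset.univ.filter fun S : Finset (Fin m) =>
    TropIndependent fun i : {i // i ∈ S} => A.row i).sup Finset.card

/-- The tropical determinant `|A|`. -/
noncomputable def tropDet {n : ℕ} (A : Matrix (Fin n) (Fin n) ExtTrop) : ExtTrop :=
  ∑ σ : Equiv.Perm (Fin n), ∏ i, A i (σ i)

/-- `A` is tropically singular if `|A|` is a ghost or `-∞`. -/
def TropSingular {n : ℕ} (A : Matrix (Fin n) (Fin n) ExtTrop) : Prop :=
  tropDet A ∈ ghostBar

/-- Tropically nonsingular (also called tropically regular) matrices. -/
def TropNonsingular {n : ℕ} (A : Matrix (Fin n) (Fin n) ExtTrop) : Prop :=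
  ¬ TropSingular A

/-- The adjoint matrix: its `(i, j)` entry is the determinant of the matrix that results from `A`
by deleting row `j` and column `i`. -/
noncomputable def tropAdj : {n : ℕ} → Matrix (Fin n) (Fin n) ExtTrop →
    Matrix (Fin n) (Fin n) ExtTrop
  | 0, A => A
  | _ + 1, A => Matrix.of fun i j => tropDet (A.submatrix j.succAbove i.succAbove)

/-- Pseudo unit matrices: nonsingular, with the real number `0` (the unit of `𝕋`) everywhere on
the main diagonal, and with off-diagonal entries that are ghosts or `-∞`. -/
def IsPseudoUnit {n : ℕ} (U : Matrix (Fin n) (Fin n) ExtTrop) : Prop :=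
  TropNonsingular U ∧ (∀ i, U i i = real 0) ∧ ∀ i j, i ≠ j → U i j ∈ ghostBar

/-- `B` is a pseudo inverse of `A`. -/
def IsPseudoInverse {n : ℕ} (A B : Matrix (Fin n) (Fin n) ExtTrop) : Prop :=
  IsPseudoUnit (A * B) ∧ IsPseudoUnit (B * A)

/-- `A` is pseudo invertible. -/
def PseudoInvertible {n : ℕ} (A : Matrix (Fin n) (Fin n) ExtTrop) : Prop :=
  ∃ B : Matrix (Fin n) (Fin n) ExtTrop, IsPseudoInverse A B

/-- The matrix `adj(A) / |A|`. -/
noncomputable def canonicalPseudoInverse {n : ℕ} (A : Matrix (Fin n) (Fin n) ExtTrop) :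
    Matrix (Fin n) (Fin n) ExtTrop :=
  Matrix.of fun i j => tropAdj A i j / tropDet A

end ExtTrop

/-! A sum in 𝕋 is real exactly when one real term strictly exceeds all others in value. Hence `A` is
nonsingular exactly when a single permutation σ attains the maximal weight and its entries are real
(`tropNonsingular_iff`), and everything reduces to comparing permutations.

Nonsingular implies independent: under a dependence, each row i with finite coefficient is matched
in column σ i by another row, and a cycle of such matches reroutes σ to a different permutation of
at least the same weight. Conversely, if `A` is singular, the minors along a suitable column serve
as coefficients: that column yields the singular determinant, every other column a determinant with
a repeated column. If |A| = -∞, the minors are taken after a minimal set of columns has been filled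
with zeros.

A dependence of the rows of `A` is inherited by `A * B`, so pseudo invertible matrices are
nonsingular. For B = adj(A)/|A|, entry (i, k) of `A * B` is the determinant of `A` with row k
replaced by row i, divided by |A|; this is 0 on the diagonal and ghost or -∞ off it. The hard point
is that `A * B` is nonsingular: a competing permutation π ≠ 1 would give n permutations whose edges
cover every row and column of `A` n times with total weight at least n|A|. By Birkhoff's theorem
(`edges_eq_of_regular`) all these edges lie on σ, which forces π = 1. -/

namespace ExtTrop

/-! ### Values, and real versus ghost sums and products -/

/-- The value of an element of `𝕋`, forgetting whether it is a ghost. -/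
def val : ExtTrop → WithBot ℝ
  | negInf => ⊥
  | real a => (a : WithBot ℝ)
  | ghost a => (a : WithBot ℝ)

@[simp] theorem val_negInf : val negInf = ⊥ := rfl

@[simp] theorem val_real (a : ℝ) : val (real a) = (a : WithBot ℝ) := rfl

@[simp] theorem val_ghost (a : ℝ) : val (ghost a) = (a : WithBot ℝ) := rfl

@[simp] theorem val_zero : val 0 = ⊥ := rfl

@[simp] theorem val_one : val 1 = 0 := rfl

@[simp] theorem val_eq_bot {x : ExtTrop} : val x = ⊥ ↔ x = negInf := by
  cases x <;> simp

theorem val_add (x y : ExtTrop) : val (x + y) = val x ⊔ val y := by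
  rcases x with _ | a | a <;> rcases y with _ | b | b <;>
    simp only [negInf_add, add_negInf, real_add_real, real_add_ghost, ghost_add_real,
      ghost_add_ghost, val_negInf, val_real, val_ghost, bot_sup_eq, sup_bot_eq] <;>
    split_ifs <;> simp only [val_real, val_ghost] <;> symm <;>
    simp only [sup_eq_left, sup_eq_right, WithBot.coe_le_coe] <;> linarith

theorem val_mul (x y : ExtTrop) : val (x * y) = val x + val y := by
  rcases x with _ | a | a <;> rcases y with _ | b | b <;>
    simp [negInf_mul, mul_negInf, real_mul_real, real_mul_ghost, ghost_mul_real, ghost_mul_ghost]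

theorem val_sum {ι : Type*} (s : Finset ι) (f : ι → ExtTrop) :
    val (∑ i ∈ s, f i) = s.sup fun i => val (f i) := by
  classical
  induction s using Finset.induction_on with
  | empty => simp
  | insert a s ha ih => rw [Finset.sum_insert ha, val_add, ih, Finset.sup_insert]

theorem val_prod {ι : Type*} (s : Finset ι) (f : ι → ExtTrop) :
    val (∏ i ∈ s, f i) = ∑ i ∈ s, val (f i) := by
  classical
  induction s using Finset.induction_on with
  | empty => simp
  | insert a s ha ih => rw [Finset.prod_insert ha, val_mul, ih, Finset.sum_insert ha]

theorem notMem_ghostBar_iff {x : ExtTrop} : x ∉ ghostBar ↔ ∃ a : ℝ, x = real a := by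
  cases x <;> simp [ghostBar]

theorem real_notMem_ghostBar (a : ℝ) : real a ∉ ghostBar := notMem_ghostBar_iff.2 ⟨a, rfl⟩

theorem ne_negInf_of_notMem {x : ExtTrop} (h : x ∉ ghostBar) : x ≠ negInf := by
  rintro rfl
  exact h (Or.inl rfl)

theorem mul_notMem_ghostBar_iff {x y : ExtTrop} :
    x * y ∉ ghostBar ↔ x ∉ ghostBar ∧ y ∉ ghostBar := by
  rcases x with _ | a | a <;> rcases y with _ | b | b <;>
    simp [negInf_mul, mul_negInf, real_mul_real, real_mul_ghost, ghost_mul_real,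
      ghost_mul_ghost, ghostBar]

theorem prod_notMem_ghostBar_iff {ι : Type*} (s : Finset ι) (f : ι → ExtTrop) :
    ∏ i ∈ s, f i ∉ ghostBar ↔ ∀ i ∈ s, f i ∉ ghostBar := by
  classical
  induction s using Finset.induction_on with
  | empty => simpa [one_def] using real_notMem_ghostBar 0
  | insert a s ha ih => rw [Finset.prod_insert ha, mul_notMem_ghostBar_iff, ih]; simp

theorem mul_mem_ghostBar_left {x : ExtTrop} (hx : x ∈ ghostBar) (y : ExtTrop) :
    x * y ∈ ghostBar := by
  by_contra h
  exact (mul_notMem_ghostBar_iff.1 h).1 hx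

theorem add_notMem_ghostBar_iff {x y : ExtTrop} :
    x + y ∉ ghostBar ↔ (x ∉ ghostBar ∧ val y < val x) ∨ (y ∉ ghostBar ∧ val x < val y) := by
  rcases x with _ | a | a <;> rcases y with _ | b | b <;>
    simp only [negInf_add, add_negInf, real_add_real, real_add_ghost, ghost_add_real,
      ghost_add_ghost, apply_ite (· ∉ ghostBar), val_negInf, val_real, val_ghost,
      WithBot.coe_lt_coe] <;>
    simp [ghostBar]
  grind

/-- A sum is a real number exactly when one of its terms is a real number that strictly dominates
all other terms. -/
theorem sum_notMem_ghostBar_iff {ι : Type*} (s : Finset ι) (f : ι → ExtTrop) :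
    ∑ i ∈ s, f i ∉ ghostBar ↔
      ∃ i ∈ s, f i ∉ ghostBar ∧ ∀ j ∈ s, j ≠ i → val (f j) < val (f i) := by
  classical
  induction s using Finset.induction_on with
  | empty => simp [zero_def, ghostBar]
  | insert a s ha ih =>
    rw [Finset.sum_insert ha, add_notMem_ghostBar_iff, val_sum]
    constructor
    · rintro (⟨h, hlt⟩ | ⟨h, hlt⟩)
      · rw [Finset.sup_lt_iff (bot_le.trans_lt hlt)] at hlt
        refine ⟨a, Finset.mem_insert_self _ _, h, fun j hj hja => hlt j ?_⟩
        exact (Finset.mem_insert.1 hj).resolve_left hja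
      · obtain ⟨i, hi, hfi, hdom⟩ := ih.1 h
        refine ⟨i, Finset.mem_insert_of_mem hi, hfi, fun j hj hji => ?_⟩
        rcases Finset.mem_insert.1 hj with rfl | hj
        · refine hlt.trans_le (Finset.sup_le fun k hk => ?_)
          by_cases hki : k = i
          · rw [hki]
          · exact (hdom k hk hki).le
        · exact hdom j hj hji
    · rintro ⟨i, hi, hfi, hdom⟩
      have hbot : ⊥ < val (f i) := bot_lt_iff_ne_bot.2 fun h =>
        ne_negInf_of_notMem hfi (val_eq_bot.1 h)
      rcases Finset.mem_insert.1 hi with rfl | hi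
      · refine Or.inl ⟨hfi, (Finset.sup_lt_iff hbot).2 fun j hj => ?_⟩
        exact hdom j (Finset.mem_insert_of_mem hj) fun h => ha (h ▸ hj)
      · refine Or.inr ⟨ih.2 ⟨i, hi, hfi, fun j hj => hdom j (Finset.mem_insert_of_mem hj)⟩, ?_⟩
        refine lt_of_lt_of_le (hdom a (Finset.mem_insert_self _ _) fun h => ha (h ▸ hi)) ?_
        exact Finset.le_sup (f := fun i => val (f i)) hi

theorem sum_mem_ghostBar {ι : Type*} (s : Finset ι) (f : ι → ExtTrop)
    (h : ∀ i ∈ s, f i ∈ ghostBar) : ∑ i ∈ s, f i ∈ ghostBar := by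
  by_contra hs
  obtain ⟨i, hi, hfi, -⟩ := (sum_notMem_ghostBar_iff s f).1 hs
  exact hfi (h i hi)

theorem sum_val_eq_bot_iff {ι : Type*} (s : Finset ι) (f : ι → ExtTrop) :
    ∑ i ∈ s, val (f i) = ⊥ ↔ ∃ i ∈ s, f i = negInf := by
  simp [WithBot.sum_eq_bot_iff]

/-! ### Determinants through optimal permutations -/

theorem tropNonsingular_iff {n : ℕ} {A : Matrix (Fin n) (Fin n) ExtTrop} :
    TropNonsingular A ↔ ∃ σ : Equiv.Perm (Fin n), (∀ i, A i (σ i) ∉ ghostBar) ∧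
      ∀ τ : Equiv.Perm (Fin n), τ ≠ σ → ∑ i, val (A i (τ i)) < ∑ i, val (A i (σ i)) := by
  simp [TropNonsingular, TropSingular, tropDet, sum_notMem_ghostBar_iff, val_prod,
    prod_notMem_ghostBar_iff]

theorem val_tropDet {n : ℕ} (A : Matrix (Fin n) (Fin n) ExtTrop) :
    val (tropDet A) = Finset.univ.sup fun σ : Equiv.Perm (Fin n) => ∑ i, val (A i (σ i)) := by
  simp [tropDet, val_sum, val_prod]

theorem exists_val_tropDet_eq {n : ℕ} (A : Matrix (Fin n) (Fin n) ExtTrop) :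
    ∃ τ : Equiv.Perm (Fin n), val (tropDet A) = ∑ i, val (A i (τ i)) := by
  obtain ⟨τ, -, hτ⟩ := Finset.exists_mem_eq_sup Finset.univ ⟨1, Finset.mem_univ _⟩
    fun τ : Equiv.Perm (Fin n) => ∑ i, val (A i (τ i))
  exact ⟨τ, (val_tropDet A).trans hτ⟩

theorem sum_val_le_val_tropDet {n : ℕ} (A : Matrix (Fin n) (Fin n) ExtTrop)
    (τ : Equiv.Perm (Fin n)) : ∑ i, val (A i (τ i)) ≤ val (tropDet A) := by
  rw [val_tropDet]
  exact Finset.le_sup (f := fun τ : Equiv.Perm (Fin n) => ∑ i, val (A i (τ i)))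
    (Finset.mem_univ τ)

theorem tropDet_transpose {n : ℕ} (A : Matrix (Fin n) (Fin n) ExtTrop) :
    tropDet A.transpose = tropDet A := by
  rw [tropDet, tropDet, ← Equiv.sum_comp (Equiv.inv (Equiv.Perm (Fin n)))]
  refine Finset.sum_congr rfl fun σ _ => ?_
  rw [← Equiv.prod_comp σ]
  simp

/-! ### Dependence and full rank -/

/-- Tropical dependence of the rows of a matrix, in coordinates. -/
theorem tropDependent_iff {ι : Type} [Fintype ι] {n : ℕ} {v : ι → Fin n → ExtTrop} :
    TropDependent v ↔ ∃ α : ι → ExtTrop, (∀ i, α i ∈ realBar) ∧ (∃ i, α i ≠ negInf) ∧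
      ∀ j, ∑ i, α i * v i j ∈ ghostBar := by
  simp [TropDependent]

theorem tropDependent_comp_equiv {ι κ : Type} [Fintype ι] [Fintype κ] {n : ℕ} (e : κ ≃ ι)
    {v : ι → Fin n → ExtTrop} (h : TropDependent fun k => v (e k)) : TropDependent v := by
  rw [tropDependent_iff] at h ⊢
  obtain ⟨α, hα, ⟨k, hk⟩, h⟩ := h
  refine ⟨fun i => α (e.symm i), fun i => hα _, ⟨e k, by simpa using hk⟩, fun j => ?_⟩
  rw [← Equiv.sum_comp e]
  simpa using h j

theorem tropRank_eq_iff {n : ℕ} {A : Matrix (Fin n) (Fin n) ExtTrop} :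
    tropRank A = n ↔ TropIndependent A := by
  classical
  have huniv : (TropIndependent fun i : {i // i ∈ (Finset.univ : Finset (Fin n))} => A.row i) ↔
      TropIndependent A := by
    refine not_congr ⟨fun h => ?_, fun h => ?_⟩
    · exact tropDependent_comp_equiv (Equiv.subtypeUnivEquiv fun i => Finset.mem_univ i) h
    · exact tropDependent_comp_equiv
        (Equiv.subtypeUnivEquiv fun i => Finset.mem_univ (i : Fin n)).symm h
  rw [← huniv, tropRank]
  constructor
  · intro h
    obtain ⟨S, hS, hcard⟩ := Finset.exists_mem_eq_sup
      (Finset.univ.filter fun S : Finset (Fin n) =>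
        TropIndependent fun i : {i // i ∈ S} => A.row i)
      -- The empty family is independent, having no coefficient different from -∞, so the maximum is
      -- attained.
      ⟨∅, by simp [TropIndependent, TropDependent]⟩ Finset.card
    have hS' : S = Finset.univ := by
      rw [← Finset.card_eq_iff_eq_univ, ← hcard, Fintype.card_fin]
      convert h
    subst hS'
    exact (Finset.mem_filter.1 hS).2
  · intro h
    apply le_antisymm
    · exact Finset.sup_le fun S _ => by simpa using S.card_le_univ
    · refine le_trans (by simp) (Finset.le_sup (f := Finset.card) (b := Finset.univ) ?_)
      exact Finset.mem_filter.2 ⟨Finset.mem_univ _, h⟩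

/-! ### Regular edge collections and Birkhoff's theorem -/

/-- A collection of edges that covers every row and every column the same number of times, and
whose total weight is at least as large as that of equally many copies of the unique optimal
permutation `σ`, consists of edges of `σ` only. -/
theorem edges_eq_of_regular {n : ℕ} (a : Fin n → Fin n → ℝ) (F : Fin n → Fin n → Prop)
    (σ : Equiv.Perm (Fin n))
    (hopt : ∀ τ : Equiv.Perm (Fin n), (∀ k, F k (τ k)) → τ ≠ σ →
      ∑ k, a k (τ k) < ∑ k, a k (σ k))
    {ι : Type*} [Fintype ι] (p q : ι → Fin n) (N : ℕ)
    (hp : ∀ i, (Finset.univ.filter fun x => p x = i).card = N)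
    (hq : ∀ j, (Finset.univ.filter fun x => q x = j).card = N)
    (hF : ∀ x, F (p x) (q x)) (hle : N * ∑ k, a k (σ k) ≤ ∑ x, a (p x) (q x)) (x : ι) :
    q x = σ (p x) := by
  have hN : (0 : ℝ) < N := by
    rw [← hp (p x)]
    exact_mod_cast Finset.card_pos.2 ⟨x, by simp⟩
  -- Edge multiplicities divided by `N` form a doubly stochastic matrix, so Birkhoff's theorem makes
  -- it a convex combination of permutation matrices.
  let M : Matrix (Fin n) (Fin n) ℝ :=
    Matrix.of fun i j => (∑ x, if p x = i ∧ q x = j then (1 : ℝ) else 0) / N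
  have hM (i j) : M i j = (∑ x, if p x = i ∧ q x = j then (1 : ℝ) else 0) / N := rfl
  have hMsum (b : Fin n → Fin n → ℝ) : ∑ i, ∑ j, M i j * b i j = (∑ x, b (p x) (q x)) / N := by
    simp_rw [hM, div_mul_eq_mul_div, Finset.sum_mul, ← Finset.sum_div]
    congr 1
    calc _ = ∑ i, ∑ x, ∑ j, (if p x = i ∧ q x = j then (1 : ℝ) else 0) * b i j :=
          Finset.sum_congr rfl fun i _ => Finset.sum_comm
      _ = ∑ x, ∑ i, ∑ j, (if p x = i ∧ q x = j then (1 : ℝ) else 0) * b i j := Finset.sum_comm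
      _ = _ := by simp [ite_and]
  have hM0 (i j) (h : M i j ≠ 0) : ∃ x, p x = i ∧ q x = j := by
    by_contra! hne
    exact h (by rw [hM, Finset.sum_eq_zero fun x _ => if_neg fun hx => hne x hx.1 hx.2, zero_div])
  have hds : M ∈ doublyStochastic ℝ (Fin n) := by
    rw [mem_doublyStochastic_iff_sum]
    refine ⟨fun i j => ?_, fun i => ?_, fun j => ?_⟩
    · rw [hM]
      positivity
    · simp_rw [hM, ← Finset.sum_div]
      rw [Finset.sum_comm, div_eq_one_iff_eq hN.ne', ← hp i]
      simp [ite_and]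
    · simp_rw [hM, ← Finset.sum_div]
      rw [Finset.sum_comm, div_eq_one_iff_eq hN.ne', ← hq j]
      simp [ite_and]
  obtain ⟨w, hw0, hw1, hwM⟩ := exists_eq_sum_perm_of_mem_doublyStochastic hds
  have hMw (i j) : M i j = ∑ τ, w τ * if τ i = j then 1 else 0 := by
    rw [← hwM]
    simp [Matrix.sum_apply, PEquiv.toMatrix_apply, Equiv.toPEquiv_apply, eq_comm]
  -- Permutations of nonzero weight use only edges of the collection, so `hopt` applies to them.
  have hMpos (τ : Equiv.Perm (Fin n)) (hτ : w τ ≠ 0) (k) : F k (τ k) := by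
    have : M k (τ k) ≠ 0 := by
      rw [hMw]
      refine ne_of_gt (lt_of_lt_of_le (lt_of_le_of_ne (hw0 τ) hτ.symm) ?_)
      refine le_trans ?_ (Finset.single_le_sum (fun ρ _ => ?_) (Finset.mem_univ τ))
      · simp
      · exact mul_nonneg (hw0 ρ) (by positivity)
    obtain ⟨x, rfl, hx⟩ := hM0 _ _ this
    exact hx ▸ hF x
  have hwa : ∑ τ, w τ * ∑ k, a k (τ k) = (∑ x, a (p x) (q x)) / N := by
    rw [← hMsum a]
    simp_rw [hMw, Finset.sum_mul, Finset.mul_sum]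
    rw [Finset.sum_comm]
    refine Finset.sum_congr rfl fun i _ => ?_
    rw [Finset.sum_comm]
    refine Finset.sum_congr rfl fun τ _ => ?_
    simp
  have hterm (τ : Equiv.Perm (Fin n)) : w τ * ∑ k, a k (τ k) ≤ w τ * ∑ k, a k (σ k) := by
    by_cases h : w τ = 0
    · simp [h]
    · by_cases hτ : τ = σ
      · rw [hτ]
      · exact mul_le_mul_of_nonneg_left (hopt τ (hMpos τ h) hτ).le (hw0 τ)
  have hw (τ : Equiv.Perm (Fin n)) (hτ : τ ≠ σ) : w τ = 0 := by
    by_contra h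
    -- A second permutation of positive weight would pull the average strictly below the weight of
    -- `σ`.
    have hlt : ∑ τ, w τ * ∑ k, a k (τ k) < ∑ τ, w τ * ∑ k, a k (σ k) :=
      Finset.sum_lt_sum (fun τ _ => hterm τ) ⟨τ, Finset.mem_univ _,
        mul_lt_mul_of_pos_left (hopt τ (hMpos τ h) hτ) (lt_of_le_of_ne (hw0 τ) (Ne.symm h))⟩
    rw [hwa, ← Finset.sum_mul, hw1, one_mul, div_lt_iff₀ hN] at hlt
    linarith
  have hx : M (p x) (q x) ≠ 0 := by
    rw [hM]
    refine (div_pos (lt_of_lt_of_le one_pos ?_) hN).ne'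
    refine le_trans ?_ (Finset.single_le_sum (fun y _ => ?_) (Finset.mem_univ x))
    · simp
    · positivity
  by_contra hne
  apply hx
  rw [hMw]
  refine Finset.sum_eq_zero fun τ _ => ?_
  by_cases hτ : τ = σ
  · rw [if_neg (by rw [hτ]; exact fun h => hne h.symm), mul_zero]
  · rw [hw τ hτ, zero_mul]

/-! ### Nonsingular matrices have independent rows -/

/-- The periodic points of a self-map of a finite type carry a permutation that agrees with the map
on them and is the identity elsewhere. -/
theorem exists_perm_eq_or_eq {α : Type*} [Finite α] (f : α → α) (a : α) :
    ∃ g : Equiv.Perm α, (∀ x, g x = f x ∨ g x = x) ∧ ∃ m, g (f^[m] a) = f (f^[m] a) := by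
  classical
  let h : α → α := fun x => if x ∈ Function.periodicPts f then f x else x
  have hbij := Function.bijOn_periodicPts f
  have hinj : Function.Injective h := by
    intro x y hxy
    simp only [h] at hxy
    split_ifs at hxy with hx hy hy
    · exact hbij.injOn hx hy hxy
    · exact absurd (hxy ▸ hbij.mapsTo hx) hy
    · exact absurd (hxy ▸ hbij.mapsTo hy) hx
    · exact hxy
  refine ⟨Equiv.ofBijective h (Finite.injective_iff_bijective.1 hinj), fun x => ?_, ?_⟩
  · by_cases hx : x ∈ Function.periodicPts f
    · exact Or.inl (if_pos hx)
    · exact Or.inr (if_neg hx)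
  · obtain ⟨k, m, hkm, heq⟩ := Finite.exists_ne_map_eq_of_infinite fun m => f^[m] a
    wlog hlt : k < m generalizing k m
    · exact this m k hkm.symm heq.symm (lt_of_le_of_ne (not_lt.1 hlt) hkm.symm)
    refine ⟨k, if_pos (Function.mk_mem_periodicPts (Nat.sub_pos_of_lt hlt) ?_)⟩
    change f^[m - k] (f^[k] a) = f^[k] a
    rw [← Function.iterate_add_apply, Nat.sub_add_cancel hlt.le]
    exact heq.symm

theorem TropNonsingular.tropIndependent {n : ℕ} {A : Matrix (Fin n) (Fin n) ExtTrop}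
    (hA : TropNonsingular A) : TropIndependent A := by
  classical
  intro hdep
  obtain ⟨α, hα, ⟨i₀, hi₀⟩, hsum⟩ := tropDependent_iff.1 hdep
  obtain ⟨σ, hσ, hopt⟩ := tropNonsingular_iff.1 hA
  -- In column `σ i` the term of row `i` is real while the sum is not, so some other row does at
  -- least as well.
  have hstep (i : Fin n) (hi : α i ≠ negInf) : ∃ k, k ≠ i ∧ α k ≠ negInf ∧
      val (α i) + val (A i (σ i)) ≤ val (α k) + val (A k (σ i)) := by
    have hnot : ¬ ∑ k, α k * A k (σ i) ∉ ghostBar := not_not.2 (hsum (σ i))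
    rw [sum_notMem_ghostBar_iff] at hnot
    push Not at hnot
    have hαi : α i ∉ ghostBar :=
      notMem_ghostBar_iff.2 ((hα i).resolve_left hi)
    obtain ⟨k, -, hki, hk⟩ := hnot i (Finset.mem_univ i) (mul_notMem_ghostBar_iff.2 ⟨hαi, hσ i⟩)
    rw [val_mul, val_mul] at hk
    refine ⟨k, hki, fun h => ?_, hk⟩
    rw [h, val_negInf, WithBot.bot_add, le_bot_iff, WithBot.add_eq_bot, val_eq_bot,
      val_eq_bot] at hk
    exact hk.elim hi (ne_negInf_of_notMem (hσ i))
  choose! f hfne hfα hfle using hstep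
  let f' : Fin n → Fin n := fun i => if α i ≠ negInf then f i else i
  have hf' (i) (hi : α i ≠ negInf) : f' i = f i := if_pos hi
  obtain ⟨g, hg, m, hm⟩ := exists_perm_eq_or_eq f' i₀
  have hmα : α (f'^[m] i₀) ≠ negInf := by
    clear hm
    induction m with
    | zero => exact hi₀
    | succ m ih => rw [Function.iterate_succ_apply', hf' _ ih]; exact hfα _ ih
  have hgne : g ≠ 1 := by
    rintro rfl
    rw [Equiv.Perm.one_apply, hf' _ hmα] at hm
    exact hfne _ hmα hm.symm
  -- Real coefficients are needed for cancellation; the default 0 occurs only in rows that `f'`,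
  -- hence `g`, fixes.
  let β : Fin n → ℝ := fun i => (val (α i)).unbotD 0
  have hβ (i) (hi : α i ≠ negInf) : val (α i) = (β i : WithBot ℝ) := by
    obtain ⟨b, hb⟩ := WithBot.ne_bot_iff_exists.1 (mt val_eq_bot.1 hi)
    simp [β, ← hb]
  have hle (i : Fin n) : (β i : WithBot ℝ) + val (A i (σ i)) ≤
      (β (g i) : WithBot ℝ) + val (A (g i) (σ i)) := by
    rcases hg i with h | h
    · by_cases hi : α i ≠ negInf
      · rw [h, hf' i hi, ← hβ i hi, ← hβ _ (hfα i hi)]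
        exact hfle i hi
      · rw [h, show f' i = i from if_neg hi]
    · rw [h]
  have hsumle := Finset.sum_le_sum fun i (_ : i ∈ Finset.univ) => hle i
  rw [Finset.sum_add_distrib, Finset.sum_add_distrib,
    Equiv.sum_comp g fun i => (β i : WithBot ℝ), ← WithBot.coe_sum,
    WithBot.add_le_add_iff_left WithBot.coe_ne_bot] at hsumle
  -- With the coefficients cancelled, giving column `σ i` to row `g i` costs nothing, against the
  -- uniqueness of `σ`.
  refine hsumle.not_gt ((hopt (g.symm.trans σ) fun h => hgne ?_).trans_eq' ?_)
  · ext i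
    have := congrArg (fun τ => σ.symm (τ (g i))) h
    simpa using congrArg Fin.val this.symm
  · rw [← Equiv.sum_comp g]
    simp

/-! ### Singular matrices have dependent rows -/

/-- The element of `ℝ ∪ {-∞}` with a given value. -/
def ofVal : WithBot ℝ → ExtTrop
  | ⊥ => negInf
  | (a : ℝ) => real a

@[simp] theorem val_ofVal (x : WithBot ℝ) : val (ofVal x) = x := by
  cases x <;> rfl

theorem ofVal_mem_realBar (x : WithBot ℝ) : ofVal x ∈ realBar := by
  cases x
  · exact Or.inl rfl
  · exact Or.inr ⟨_, rfl⟩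

/-- The largest value of a product of entries of `B` that use every row except `i` and every
column except `c` exactly once. -/
noncomputable def minorVal {n : ℕ} (B : Matrix (Fin n) (Fin n) ExtTrop) (c i : Fin n) :
    WithBot ℝ :=
  (Finset.univ.filter fun τ : Equiv.Perm (Fin n) => τ i = c).sup
    fun τ => ∑ k ∈ Finset.univ.erase i, val (B k (τ k))

section minorVal

variable {n : ℕ} (B : Matrix (Fin n) (Fin n) ExtTrop) {c i : Fin n}

theorem le_minorVal {τ : Equiv.Perm (Fin n)} (hτ : τ i = c) :
    ∑ k ∈ Finset.univ.erase i, val (B k (τ k)) ≤ minorVal B c i :=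
  Finset.le_sup (f := fun τ : Equiv.Perm (Fin n) => ∑ k ∈ Finset.univ.erase i, val (B k (τ k)))
    (Finset.mem_filter.2 ⟨Finset.mem_univ τ, hτ⟩)

theorem exists_minorVal_eq (c i : Fin n) : ∃ τ : Equiv.Perm (Fin n), τ i = c ∧
    minorVal B c i = ∑ k ∈ Finset.univ.erase i, val (B k (τ k)) := by
  obtain ⟨τ, hτ, h⟩ := Finset.exists_mem_eq_sup
    (Finset.univ.filter fun τ : Equiv.Perm (Fin n) => τ i = c)
    ⟨Equiv.swap i c, by simp⟩ fun τ => ∑ k ∈ Finset.univ.erase i, val (B k (τ k))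
  exact ⟨τ, (Finset.mem_filter.1 hτ).2, h⟩

theorem sum_val_le_minorVal_add {τ : Equiv.Perm (Fin n)} (hτ : τ i = c) :
    ∑ k, val (B k (τ k)) ≤ minorVal B c i + val (B i c) := by
  rw [← Finset.sum_erase_add _ _ (Finset.mem_univ i), hτ]
  gcongr
  exact le_minorVal B hτ

theorem exists_minorVal_add_eq (c i : Fin n) : ∃ τ : Equiv.Perm (Fin n), τ i = c ∧
    minorVal B c i + val (B i c) = ∑ k, val (B k (τ k)) := by
  obtain ⟨τ, hτ, h⟩ := exists_minorVal_eq B c i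
  refine ⟨τ, hτ, ?_⟩
  rw [h, ← Finset.sum_erase_add _ _ (Finset.mem_univ i), hτ]

/-- The minors along a column `c` combine the rows to a vector that is ghost outside `c`. -/
theorem sum_minorVal_mul_mem_ghostBar {j : Fin n} (hj : j ≠ c) :
    ∑ i, ofVal (minorVal B c i) * B i j ∈ ghostBar := by
  by_contra h
  obtain ⟨i, -, hi, hdom⟩ := (sum_notMem_ghostBar_iff _ _).1 h
  obtain ⟨τ, hτ, hmin⟩ := exists_minorVal_eq B c i
  set i' := τ.symm j with hi'
  have hτi' : τ i' = j := τ.apply_symm_apply j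
  have hne : i' ≠ i := fun h => hj (by rw [← hτi', h, hτ])
  refine (hdom i' (Finset.mem_univ _) hne).not_ge ?_
  rw [val_mul, val_mul, val_ofVal, val_ofVal, hmin]
  -- The dominant product for row `i` also uses the entry of row `i'` in column `j`. Swapping the
  -- columns assigned to `i` and `i'` reads the same product as a term for row `i'`, so there is a
  -- tie.
  refine le_trans (le_of_eq ?_)
    (add_le_add_left (le_minorVal B (τ := (Equiv.swap i i').trans τ) (i := i') (c := c)
      (by simp [hτ])) _)
  rw [← Finset.sum_erase_add _ _ (Finset.mem_erase.2 ⟨hne, Finset.mem_univ i'⟩),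
    ← Finset.sum_erase_add _ _ (Finset.mem_erase.2 ⟨hne.symm, Finset.mem_univ i⟩),
    Finset.erase_right_comm, hτi', add_right_comm]
  congr 2
  · refine Finset.sum_congr rfl fun k hk => ?_
    simp only [Finset.mem_erase] at hk
    rw [Equiv.trans_apply, Equiv.swap_apply_of_ne_of_ne hk.1 hk.2.1]
  · simp [hτi']

end minorVal

theorem tropDependent_of_val_tropDet_ne_bot {n : ℕ} {A : Matrix (Fin n) (Fin n) ExtTrop}
    (hA : TropSingular A) (hdet : tropDet A ≠ negInf) : TropDependent A := by
  obtain ⟨σ, hσ⟩ := exists_val_tropDet_eq A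
  have hle (τ : Equiv.Perm (Fin n)) : ∑ i, val (A i (τ i)) ≤ ∑ i, val (A i (σ i)) :=
    hσ ▸ sum_val_le_val_tropDet A τ
  -- Singularity is witnessed at a row `k`: its entry on `σ` is not real, or another optimal
  -- permutation leaves `σ` there. Column `σ k` is the one to expand along.
  have hk : ∃ k, A k (σ k) ∈ ghostBar ∨ ∃ τ : Equiv.Perm (Fin n), τ k ≠ σ k ∧
      ∑ i, val (A i (σ i)) ≤ ∑ i, val (A i (τ i)) := by
    by_contra! hk
    refine tropNonsingular_iff.2 ⟨σ, fun i => (hk i).1, fun τ hτ => ?_⟩ hA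
    obtain ⟨k, hne⟩ := DFunLike.ne_iff.1 hτ
    exact (hk k).2 τ hne
  obtain ⟨k, hk⟩ := hk
  refine tropDependent_iff.2 ⟨fun i => ofVal (minorVal A (σ k) i), fun i => ofVal_mem_realBar _,
    ⟨k, fun h => hdet ?_⟩, fun j => ?_⟩
  · rw [← val_eq_bot, val_ofVal] at h
    rw [← val_eq_bot, hσ, ← le_bot_iff]
    refine (sum_val_le_minorVal_add A (i := k) rfl).trans ?_
    rw [h, WithBot.bot_add]
  by_cases hj : j = σ k
  · subst hj
    by_contra h
    obtain ⟨i, -, hi, hdom⟩ := (sum_notMem_ghostBar_iff _ _).1 h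
    simp only [val_mul, val_ofVal] at hdom
    obtain ⟨ρ, hρ, hρeq⟩ := exists_minorVal_add_eq A (σ k) i
    have hik : k = i := by
      by_contra hne
      refine (hdom k (Finset.mem_univ _) hne).not_ge ?_
      rw [hρeq]
      exact (hle ρ).trans (sum_val_le_minorVal_add A rfl)
    subst hik
    rcases hk with hk | ⟨τ, hτ, hστ⟩
    · exact (mul_notMem_ghostBar_iff.1 hi).2 hk
    · refine (hdom (τ.symm (σ k)) (Finset.mem_univ _) fun h => hτ ?_).not_ge ?_
      · rw [← h, Equiv.apply_symm_apply, h]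
      · rw [hρeq]
        exact (hle ρ).trans (hστ.trans (sum_val_le_minorVal_add A (τ.apply_symm_apply _)))
  · exact sum_minorVal_mul_mem_ghostBar A hj

theorem tropDependent_of_tropDet_eq_negInf {n : ℕ} {A : Matrix (Fin n) (Fin n) ExtTrop}
    (hdet : tropDet A = negInf) : TropDependent A := by
  let P : Finset (Fin n) → Prop := fun J =>
    ∃ τ : Equiv.Perm (Fin n), ∀ k, τ k ∈ J ∨ A k (τ k) ≠ negInf
  -- `J` is a minimal set of columns whose replacement by zeros makes the determinant finite.
  obtain ⟨J, hJ⟩ := exists_minimal_of_wellFoundedLT P ⟨Finset.univ, 1, by simp⟩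
  have herase (j) (hj : j ∈ J) : ¬ P (J.erase j) := fun h =>
    Finset.notMem_erase j J (hJ.le_of_le h (Finset.erase_subset _ _) hj)
  obtain ⟨c, hc⟩ : J.Nonempty := by
    rw [Finset.nonempty_iff_ne_empty]
    rintro rfl
    obtain ⟨τ, hτ⟩ := hJ.prop
    have h := le_bot_iff.1 ((sum_val_le_val_tropDet A τ).trans_eq (val_eq_bot.2 hdet))
    obtain ⟨i, -, hi⟩ := (sum_val_eq_bot_iff _ _).1 h
    simpa [hi] using hτ i
  let B : Matrix (Fin n) (Fin n) ExtTrop := Matrix.of fun i j => if j ∈ J then real 0 else A i j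
  have hB (i j) : B i j = if j ∈ J then real 0 else A i j := rfl
  have hBne (i j) : B i j ≠ negInf ↔ j ∈ J ∨ A i j ≠ negInf := by
    rw [hB]
    split_ifs with h <;> simp [h]
  refine tropDependent_iff.2 ⟨fun i => ofVal (minorVal B c i), fun i => ofVal_mem_realBar _,
    ?_, fun j => ?_⟩
  · obtain ⟨τ, hτ⟩ := hJ.prop
    refine ⟨τ.symm c, fun h => ?_⟩
    rw [← val_eq_bot, val_ofVal, ← le_bot_iff] at h
    obtain ⟨k, -, hk⟩ := (sum_val_eq_bot_iff _ _).1
      (le_bot_iff.1 ((le_minorVal B (τ.apply_symm_apply c)).trans h))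
    exact (hBne _ _).2 (hτ k) hk
  by_cases hj : j ∈ J
  · refine sum_mem_ghostBar _ _ fun i _ => ?_
    by_cases hA : A i j = negInf
    · rw [hA, mul_negInf]
      exact Or.inl rfl
    by_cases hi : minorVal B c i = ⊥
    · simp only [hi]
      exact Or.inl rfl
    exfalso
    obtain ⟨τ, hτ, hmin⟩ := exists_minorVal_eq B c i
    have hfin (k) (hk : k ≠ i) : τ k ∈ J ∨ A k (τ k) ≠ negInf := by
      rw [← hBne]
      intro h
      exact hi (hmin.trans ((sum_val_eq_bot_iff _ _).2 ⟨k, by simpa using hk, h⟩))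
    -- With a finite minor and a finite `A i j`, row `i` can take column `j` and hand column `c` to
    -- the former owner of `j`; then `J.erase j` suffices, against minimality.
    refine herase j hj ⟨(Equiv.swap i (τ.symm j)).trans τ, fun k => ?_⟩
    by_cases hki : k = i
    · subst hki
      right
      simpa using hA
    by_cases hkj : k = τ.symm j
    · subst hkj
      left
      simp only [Equiv.trans_apply, Equiv.swap_apply_right, hτ, Finset.mem_erase]
      refine ⟨fun h => hki ?_, hc⟩
      rw [← h, ← hτ, Equiv.symm_apply_apply]
    · rw [Equiv.trans_apply, Equiv.swap_apply_of_ne_of_ne hki hkj]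
      refine (hfin k hki).imp_left fun h => Finset.mem_erase.2 ⟨fun h' => hkj ?_, h⟩
      rw [← h', Equiv.symm_apply_apply]
  · have := sum_minorVal_mul_mem_ghostBar B (c := c) (j := j) fun h => hj (h ▸ hc)
    simpa [hB, hj] using this

theorem tropIndependent_iff_tropNonsingular {n : ℕ} {A : Matrix (Fin n) (Fin n) ExtTrop} :
    TropIndependent A ↔ TropNonsingular A := by
  refine ⟨fun h hA => h ?_, TropNonsingular.tropIndependent⟩
  by_cases hdet : tropDet A = negInf
  · exact tropDependent_of_tropDet_eq_negInf hdet
  · exact tropDependent_of_val_tropDet_ne_bot hA hdet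

/-! ### Pseudo invertible matrices are nonsingular -/

theorem PseudoInvertible.tropNonsingular {n : ℕ} {A : Matrix (Fin n) (Fin n) ExtTrop}
    (h : PseudoInvertible A) : TropNonsingular A := by
  obtain ⟨B, ⟨hAB, -⟩, -⟩ := h
  rw [← tropIndependent_iff_tropNonsingular] at hAB ⊢
  intro hdep
  obtain ⟨α, hα, hne, hsum⟩ := tropDependent_iff.1 hdep
  refine hAB (tropDependent_iff.2 ⟨α, hα, hne, fun j => ?_⟩)
  have : ∑ i, α i * (A * B) i j = ∑ k, (∑ i, α i * A i k) * B k j := by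
    simp_rw [Matrix.mul_apply, Finset.mul_sum, Finset.sum_mul, mul_assoc]
    exact Finset.sum_comm
  rw [this]
  exact sum_mem_ghostBar _ _ fun k _ => mul_mem_ghostBar_left (hsum k) _

/-! ### The adjoint as a pseudo inverse -/

/-- The Laplace expansion of the tropical determinant along the row `k`. -/
theorem tropDet_succ_row {n : ℕ} (M : Matrix (Fin (n + 1)) (Fin (n + 1)) ExtTrop)
    (k : Fin (n + 1)) :
    tropDet M = ∑ j, M k j * tropDet (M.submatrix k.succAbove j.succAbove) := by
  let F : Fin (n + 1) × Equiv.Perm (Fin n) → Equiv.Perm (Fin (n + 1)) := fun x =>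
    ((finSuccEquiv' k).trans (Equiv.optionCongr x.2)).trans (finSuccEquiv' x.1).symm
  have hFk (x) : F x k = x.1 := by simp [F]
  have hFs (x) (i : Fin n) : F x (k.succAbove i) = x.1.succAbove (x.2 i) := by simp [F]
  have hinj : Function.Injective F := by
    rintro ⟨j, ρ⟩ ⟨j', ρ'⟩ h
    obtain rfl : j = j' := (hFk _).symm.trans ((DFunLike.congr_fun h k).trans (hFk _))
    refine Prod.ext rfl (Equiv.ext fun i => Fin.succAbove_right_injective (p := j) ?_)
    exact (hFs _ i).symm.trans ((DFunLike.congr_fun h _).trans (hFs _ i))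
  have hbij : Function.Bijective F := by
    rw [Fintype.bijective_iff_injective_and_card]
    exact ⟨hinj, by simp [Fintype.card_perm, Nat.factorial_succ]⟩
  simp_rw [tropDet, Finset.mul_sum]
  rw [← Fintype.sum_prod_type', ← hbij.sum_comp fun σ => ∏ i, M i (σ i)]
  refine Finset.sum_congr rfl fun x _ => ?_
  rw [Fin.prod_univ_succAbove _ k, hFk]
  simp [hFs]

theorem tropAdj_transpose {n : ℕ} (A : Matrix (Fin n) (Fin n) ExtTrop) :
    tropAdj A.transpose = (tropAdj A).transpose := by
  cases n with
  | zero => exact Subsingleton.elim _ _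
  | succ n =>
    ext i j
    simp only [tropAdj, Matrix.of_apply, Matrix.transpose_apply]
    rw [← tropDet_transpose, Matrix.transpose_submatrix, Matrix.transpose_transpose]

/-- Transposition exchanges the two products with the pseudo inverse, so only one of them has to be
analysed. -/
theorem canonicalPseudoInverse_transpose {n : ℕ} (A : Matrix (Fin n) (Fin n) ExtTrop) :
    canonicalPseudoInverse A.transpose = (canonicalPseudoInverse A).transpose := by
  ext i j
  simp [canonicalPseudoInverse, tropAdj_transpose, tropDet_transpose]

theorem tropNonsingular_transpose {n : ℕ} {A : Matrix (Fin n) (Fin n) ExtTrop} :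
    TropNonsingular A.transpose ↔ TropNonsingular A := by
  rw [TropNonsingular, TropNonsingular, TropSingular, TropSingular, tropDet_transpose]

theorem IsPseudoUnit.transpose {n : ℕ} {U : Matrix (Fin n) (Fin n) ExtTrop}
    (hU : IsPseudoUnit U) : IsPseudoUnit U.transpose :=
  ⟨tropNonsingular_transpose.2 hU.1, hU.2.1, fun i j hij => hU.2.2 j i hij.symm⟩

/-- With rows `i` and `k` equal, swapping them turns any optimal permutation into a different one of
the same weight. -/
theorem tropDet_updateRow_mem_ghostBar {n : ℕ} (A : Matrix (Fin n) (Fin n) ExtTrop)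
    {i k : Fin n} (hik : i ≠ k) : tropDet (A.updateRow k (A i)) ∈ ghostBar := by
  by_contra h
  obtain ⟨σ, -, hopt⟩ := tropNonsingular_iff.1 h
  refine (hopt ((Equiv.swap i k).trans σ) fun h => hik ?_).ne ?_
  · have := DFunLike.congr_fun h i
    simpa using this.symm
  · rw [← Equiv.sum_comp (Equiv.swap i k)]
    refine Finset.sum_congr rfl fun r _ => ?_
    rw [Equiv.trans_apply, Equiv.swap_apply_self]
    congr 1
    rcases eq_or_ne r i with rfl | hri
    · simp [hik]
    rcases eq_or_ne r k with rfl | hrk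
    · simp [hik]
    · rw [Equiv.swap_apply_of_ne_of_ne hri hrk]

theorem mul_canonicalPseudoInverse_apply {n : ℕ} (A : Matrix (Fin n) (Fin n) ExtTrop) {d : ℝ}
    (hd : tropDet A = real d) (i k : Fin n) :
    (A * canonicalPseudoInverse A) i k = tropDet (A.updateRow k (A i)) * real (-d) := by
  cases n with
  | zero => exact i.elim0
  | succ n =>
    rw [tropDet_succ_row _ k, Finset.sum_mul, Matrix.mul_apply]
    refine Finset.sum_congr rfl fun j _ => ?_
    rw [Matrix.updateRow_self, mul_assoc]
    congr 1
    rw [canonicalPseudoInverse, hd]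
    change tropDet _ * real (-d) = _
    congr 2
    ext r s
    simp

theorem updateRow_row_apply {n : ℕ} (A : Matrix (Fin n) (Fin n) ExtTrop) (i k r s : Fin n) :
    A.updateRow k (A i) r s = A (if r = k then i else r) s := by
  rw [Matrix.updateRow_apply]
  split_ifs <;> rfl

/-- Replacing the row `π i` by the row `i`, for all `i`, uses every row equally often. -/
theorem card_filter_replaced_row {n : ℕ} (π : Equiv.Perm (Fin n)) (i₀ : Fin n) :
    (Finset.univ.filter fun x : Fin n × Fin n =>
      (if x.2 = π x.1 then x.1 else x.2) = i₀).card = n := by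
  let b : Fin n → ℕ := fun i => if i = i₀ then 1 else 0
  -- Each replacement gains row `i` and loses row `π i`; summed over `i` the two effects cancel
  -- since `π` is bijective.
  have hrow (i : Fin n) :
      ∑ r, b (if r = π i then i else r) + b (π i) = ∑ r, b r + b i := by
    rw [← Finset.sum_erase_add _ _ (Finset.mem_univ (π i)),
      ← Finset.sum_erase_add Finset.univ b (Finset.mem_univ (π i)), if_pos rfl,
      Finset.sum_congr rfl fun r hr => by rw [if_neg (Finset.ne_of_mem_erase hr)]]
    ring
  have hsum : ∑ i, ∑ r, b (if r = π i then i else r) + ∑ i, b (π i) =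
      ∑ i : Fin n, ∑ r, b r + ∑ i, b i := by
    rw [← Finset.sum_add_distrib, ← Finset.sum_add_distrib]
    exact Finset.sum_congr rfl fun i _ => hrow i
  rw [Equiv.sum_comp π b, Nat.add_right_cancel_iff] at hsum
  rw [Finset.card_filter, Fintype.sum_prod_type]
  exact hsum.trans (by simp [b])

theorem card_filter_perm_apply_eq {n : ℕ} (τ : Fin n → Equiv.Perm (Fin n)) (j : Fin n) :
    (Finset.univ.filter fun x : Fin n × Fin n => τ x.1 x.2 = j).card = n := by
  rw [Finset.card_filter, Fintype.sum_prod_type]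
  simp [← Equiv.eq_symm_apply]

theorem TropNonsingular.isPseudoUnit_mul {n : ℕ} {A : Matrix (Fin n) (Fin n) ExtTrop}
    (hA : TropNonsingular A) : IsPseudoUnit (A * canonicalPseudoInverse A) := by
  obtain ⟨d, hd⟩ := notMem_ghostBar_iff.1 hA
  have hU := mul_canonicalPseudoInverse_apply A hd
  have hdiag (i : Fin n) : (A * canonicalPseudoInverse A) i i = real 0 := by
    rw [hU, Matrix.updateRow_eq_self, hd, real_mul_real, add_neg_cancel]
  refine ⟨tropNonsingular_iff.2 ⟨1, fun i => ?_, fun π hπ => ?_⟩, hdiag, fun i k hik => ?_⟩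
  · rw [Equiv.Perm.one_apply, hdiag]
    exact real_notMem_ghostBar 0
  · by_contra! hle
    simp only [Equiv.Perm.one_apply, hdiag, hU, val_mul, val_real, WithBot.coe_zero,
      Finset.sum_const_zero] at hle
    obtain ⟨σ, hσ, hopt⟩ := tropNonsingular_iff.1 hA
    choose τ hτ using fun i => exists_val_tropDet_eq (A.updateRow (π i) (A i))
    simp only [hτ, updateRow_row_apply] at hle
    -- The default 0 at entries -∞ is harmless: only permutations and edges through finite entries
    -- are compared.
    let a : Fin n → Fin n → ℝ := fun p q => (val (A p q)).unbotD 0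
    have ha {p q} (h : A p q ≠ negInf) : val (A p q) = (a p q : WithBot ℝ) := by
      obtain ⟨b, hb⟩ := WithBot.ne_bot_iff_exists.1 (mt val_eq_bot.1 h)
      simp [a, ← hb]
    -- One entry -∞ would make the whole sum -∞, whereas `hle` bounds it below by 0.
    have hfin (i r) : A (if r = π i then i else r) (τ i r) ≠ negInf := by
      intro h
      refine (WithBot.bot_lt_coe (0 : ℝ)).not_ge (hle.trans_eq ?_)
      refine WithBot.sum_eq_bot_iff.2 ⟨i, Finset.mem_univ _, WithBot.add_eq_bot.2 (Or.inl ?_)⟩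
      exact WithBot.sum_eq_bot_iff.2 ⟨r, Finset.mem_univ _, val_eq_bot.2 h⟩
    have hsum {ρ : Equiv.Perm (Fin n)} (h : ∀ k, A k (ρ k) ≠ negInf) :
        ∑ k, val (A k (ρ k)) = ((∑ k, a k (ρ k) : ℝ) : WithBot ℝ) := by
      rw [WithBot.coe_sum]
      exact Finset.sum_congr rfl fun k _ => ha (h k)
    have hσfin (k) : A k (σ k) ≠ negInf := ne_negInf_of_notMem (hσ k)
    have hdσ : d = ∑ k, a k (σ k) := by
      rw [← WithBot.coe_inj, ← hsum hσfin, ← val_real, ← hd]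
      refine le_antisymm ?_ (sum_val_le_val_tropDet A σ)
      obtain ⟨ρ, hρ⟩ := exists_val_tropDet_eq A
      rw [hρ]
      by_cases h : ρ = σ
      · rw [h]
      · exact (hopt ρ h).le
    simp only [ha (hfin _ _)] at hle
    norm_cast at hle
    rw [Finset.sum_add_distrib, Finset.sum_const, Finset.card_univ, Fintype.card_fin,
      nsmul_eq_mul, hdσ] at hle
    have hedge := edges_eq_of_regular a (fun p q => A p q ≠ negInf) σ
      (fun ρ hρ hne => by
        have := hopt ρ hne
        rwa [hsum hρ, hsum hσfin, WithBot.coe_lt_coe] at this)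
      (fun x : Fin n × Fin n => if x.2 = π x.1 then x.1 else x.2) (fun x => τ x.1 x.2) n
      (card_filter_replaced_row π) (card_filter_perm_apply_eq τ) (fun x => hfin x.1 x.2)
      (by rw [Fintype.sum_prod_type]; linarith)
    refine hπ (Equiv.ext fun i => ?_)
    by_contra hne
    -- If `π i ≠ i`, positions `π i` and `i` of the modified matrix both hold row `i`, so the
    -- injective `τ i` would send both to column `σ i`.
    have h₁ : τ i (π i) = σ i := (hedge (i, π i)).trans (congrArg σ (if_pos rfl))
    have h₂ : τ i i = σ i := (hedge (i, i)).trans (congrArg σ (if_neg (Ne.symm hne)))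
    exact hne ((τ i).injective (h₁.trans h₂.symm))
  · rw [hU]
    exact mul_mem_ghostBar_left (tropDet_updateRow_mem_ghostBar A hik) _

theorem TropNonsingular.isPseudoInverse_canonicalPseudoInverse {n : ℕ}
    {A : Matrix (Fin n) (Fin n) ExtTrop} (hA : TropNonsingular A) :
    IsPseudoInverse A (canonicalPseudoInverse A) := by
  refine ⟨hA.isPseudoUnit_mul, ?_⟩
  have h := (tropNonsingular_transpose.2 hA).isPseudoUnit_mul.transpose
  rwa [canonicalPseudoInverse_transpose, Matrix.transpose_mul, Matrix.transpose_transpose,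
    Matrix.transpose_transpose] at h

end ExtTrop

theorem mainTheorem3 (n : ℕ) (A : Matrix (Fin n) (Fin n) ExtTrop) :
    (ExtTrop.tropRank A = n ↔ ExtTrop.TropNonsingular A) ∧
    (ExtTrop.TropNonsingular A ↔ ExtTrop.PseudoInvertible A) ∧
    (ExtTrop.TropNonsingular A →
      ExtTrop.IsPseudoInverse A (ExtTrop.canonicalPseudoInverse A)) :=
  ⟨ExtTrop.tropRank_eq_iff.trans ExtTrop.tropIndependent_iff_tropNonsingular,
    ⟨fun h => ⟨_, h.isPseudoInverse_canonicalPseudoInverse⟩, fun h => h.tropNonsingular⟩,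
    fun h => h.isPseudoInverse_canonicalPseudoInverse⟩
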